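/- Let $l,n,d$ be natural numbers and let $d_1,\dots,d_n$ be natural numbers. Alice has an input $x\in\{1,\dots,l\}$, Bob has an input $y\in\{1,\dots,n\}$ and an output $b\in\{1,\dots,d_y\}$. A table $p=(p(b|x,y))_{x,y,b}$ of real numbers records their input-output statistics. A POVM on $\mathbb C^d$ is a (discrete) family $(E_\kappa)_\kappa$ of positive semidefinite $d\times d$ matrices with $\sum_\kappa E_\kappa=\mathbb 1$; a state is a positive semidefinite matrix of trace $1$. A family of POVMs $(M_{b|i})_b$, $i\in I$, is compatible if there are a (discrete) parent POVM $(G_\kappa)_\kappa$ on $\mathbb C^d$ and numbers $P_i(b|\kappa)\ge 0$ with $\sum_b P_i(b|\kappa)=1$ such that $M_{b|i}=\sum_\kappa P_i(b|\kappa)G_\kappa$ for all $i$ and $b$. Shared randomness is a random variable $\lambda$ with values in a probability space $(\Lambda,\pi)$; all quantities below that depend on $\lambda$ depend on it measurably. Define the following sets of tables. - $\mathcal C_d$ is the set of all $p$ of the form $p(b|x,y)=\sum_{m=1}^d\int_\Lambda p_a(m|x,\lambda)\,p_b(b|y,m,\lambda)\,d\pi(\lambda)$ for some $(\Lambda,\pi)$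 and some conditional probability distributions $p_a,p_b$ (nonnegative, $\sum_m p_a(m|x,\lambda)=1=\sum_b p_b(b|y,m,\lambda)$). - $\mathcal Q^C_d$ is the set of all $p$ of the form $p(b|x,y)=\int_\Lambda \mathrm{Tr}(\rho_{x,\lambda}M_{b|y,\lambda})\,d\pi(\lambda)$ for some $(\Lambda,\pi)$, states $\rho_{x,\lambda}$ and POVMs $(M_{b|y,\lambda})_b$ on $\mathbb C^d$ such that the family of all these POVMs, indexed by $(y,\lambda)$, is compatible. (The parent POVM does not depend on $\lambda$. The post-processing may depend on $\lambda$, and this dependence need not be measurable.) - $\overline{\mathcal Q}{}^C_d$ is the set of all $p$ of the form $p(b|x,y)=\mathrm{Tr}(\rho_xM_{b|y})$ for some states $\rho_x$ and some compatible POVMs $(M_{b|y})_b$, $y\in\{1,\dots,n\}$, on $\mathbb C^d$. Then $$\overline{\mathcal Q}{}^C_d\subseteq\mathcal Q^C_d=\mathcal C_d .$$ Consequently, measurement incompatibility is necessary for any quantum advantage over classical communication, with or without shared randomness: let $p$ be the table produced by a quantum strategy on $\mathbb C^d$ with shared randomness, $p(b|x,y)=\int_\Lambda \mathrm{Tr}(\rho_{x,\lambda}M_{b|y,\lambda})\,d\pi(\lambda)$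 (respectively without it, $p(b|x,y)=\mathrm{Tr}(\rho_xM_{b|y})$), and let $f$ be any real-valued function of tables with $f(p)>f(q)$ for all $q\in\mathcal C_d$. Then the family of Bob's POVMs $(M_{b|y,\lambda})_b$, indexed by $(y,\lambda)$ (respectively $(M_{b|y})_b$, indexed by $y$), is not compatible. -/

import Mathlib

open scoped ComplexOrder

namespace PrepMeas

/-- A discrete POVM on `ℂ^d`, indexed by an arbitrary outcome set `K`: positive semidefinite
effects that sum to the identity. The sum over `K` is taken in the sense of `HasSum`; for a finite
`K` it is the usual finite sum, see `isPOVM_iff_sum`. -/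
def IsPOVM {K : Type*} {d : ℕ} (E : K → Matrix (Fin d) (Fin d) ℂ) : Prop :=
  (∀ κ, (E κ).PosSemidef) ∧ HasSum E 1

theorem isPOVM_iff_sum {K : Type*} [Fintype K] {d : ℕ} (E : K → Matrix (Fin d) (Fin d) ℂ) :
    IsPOVM E ↔ (∀ κ, (E κ).PosSemidef) ∧ ∑ κ, E κ = 1 := by
  unfold IsPOVM
  refine and_congr_right fun _ => ⟨fun h => (hasSum_fintype E).unique h, fun h => ?_⟩
  rw [← h]
  exact hasSum_fintype E

/-- A density matrix on `ℂ^d`. -/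
def IsState {d : ℕ} (ρ : Matrix (Fin d) (Fin d) ℂ) : Prop :=
  ρ.PosSemidef ∧ ρ.trace = 1

/-- Compatibility of a family of measurements `M i`, `i : ι`, where `M i` has `k i` outcomes:
there are a parent POVM `G` and post-processings `P i (b | κ)`, written `P i κ b`, such that
`M i b = ∑ κ, P i (b | κ) G κ` for all `i` and `b`. -/
def IsCompatible {ι : Type*} {d : ℕ} {k : ι → ℕ}
    (M : (i : ι) → Fin (k i) → Matrix (Fin d) (Fin d) ℂ) : Prop :=
  ∃ (K : Type) (G : K → Matrix (Fin d) (Fin d) ℂ) (P : (i : ι) → K → Fin (k i) → ℝ),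
    IsPOVM G ∧
    (∀ i κ b, 0 ≤ P i κ b) ∧
    (∀ i κ, ∑ b, P i κ b = 1) ∧
    (∀ i b, HasSum (fun κ => (P i κ b : ℂ) • G κ) (M i b))

/-- The input-output tables of a scenario: `p x y b` stands for `p(b | x, y)`. -/
abbrev Behavior (l n : ℕ) (k : Fin n → ℕ) : Type :=
  Fin l → (y : Fin n) → Fin (k y) → ℝ

/-- Encoding and decoding functions for the communication of a classical `d`-level system, given
the value `ω : Ω` of the shared randomness. -/
structure ClassicalStrategy (Ω : Type) [MeasurableSpace Ω] (l n : ℕ) (k : Fin n → ℕ)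
    (d : ℕ) where
  /-- `enc x ω m` is the probability `p_a(m | x, ω)`. -/
  enc : Fin l → Ω → Fin d → ℝ
  /-- `dec y m ω b` is the probability `p_b(b | y, m, ω)`. -/
  dec : (y : Fin n) → Fin d → Ω → Fin (k y) → ℝ
  enc_nonneg : ∀ x ω m, 0 ≤ enc x ω m
  enc_sum : ∀ x ω, ∑ m, enc x ω m = 1
  dec_nonneg : ∀ y m ω b, 0 ≤ dec y m ω b
  dec_sum : ∀ y m ω, ∑ b, dec y m ω b = 1
  enc_measurable : ∀ x m, Measurable fun ω => enc x ω m
  dec_measurable : ∀ y m b, Measurable fun ω => dec y m ω b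

/-- The strategy with shared randomness distributed according to `π` produces the table `p`. -/
def ClassicalStrategy.Realizes {Ω : Type} [MeasurableSpace Ω] {l n : ℕ} {k : Fin n → ℕ} {d : ℕ}
    (S : ClassicalStrategy Ω l n k d) (π : MeasureTheory.Measure Ω) (p : Behavior l n k) : Prop :=
  ∀ x y b, p x y b = ∑ m, ∫ ω, S.enc x ω m * S.dec y m ω b ∂π

/-- States and measurements on `ℂ^d`, given the value `ω : Ω` of the shared randomness.
Measurability in `ω` is required entrywise. -/
structure QuantumStrategy (Ω : Type) [MeasurableSpace Ω] (l n : ℕ) (k : Fin n → ℕ)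
    (d : ℕ) where
  state : Fin l → Ω → Matrix (Fin d) (Fin d) ℂ
  meas : (y : Fin n) → Ω → Fin (k y) → Matrix (Fin d) (Fin d) ℂ
  isState : ∀ x ω, IsState (state x ω)
  isPOVM : ∀ y ω, IsPOVM (meas y ω)
  state_measurable : ∀ x i j, Measurable fun ω => state x ω i j
  meas_measurable : ∀ y b i j, Measurable fun ω => meas y ω b i j

/-- The strategy with shared randomness distributed according to `π` produces the table `p`. -/
def QuantumStrategy.Realizes {Ω : Type} [MeasurableSpace Ω] {l n : ℕ} {k : Fin n → ℕ} {d : ℕ}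
    (S : QuantumStrategy Ω l n k d) (π : MeasureTheory.Measure Ω) (p : Behavior l n k) : Prop :=
  ∀ x y b, (p x y b : ℂ) = ∫ ω, (S.state x ω * S.meas y ω b).trace ∂π

/-- The whole set of the receiver's measurements, over all inputs `y` and all values `ω` of the
shared randomness, has one parent POVM; the post-processing may depend on `y` and `ω`. -/
def QuantumStrategy.Compatible {Ω : Type} [MeasurableSpace Ω] {l n : ℕ} {k : Fin n → ℕ} {d : ℕ}
    (S : QuantumStrategy Ω l n k d) : Prop :=
  IsCompatible fun i : Fin n × Ω => S.meas i.1 i.2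

/-- States and measurements on `ℂ^d`, without shared randomness. -/
structure PlainQuantumStrategy (l n : ℕ) (k : Fin n → ℕ) (d : ℕ) where
  state : Fin l → Matrix (Fin d) (Fin d) ℂ
  meas : (y : Fin n) → Fin (k y) → Matrix (Fin d) (Fin d) ℂ
  isState : ∀ x, IsState (state x)
  isPOVM : ∀ y, IsPOVM (meas y)

/-- The strategy produces the table `p`. -/
def PlainQuantumStrategy.Realizes {l n : ℕ} {k : Fin n → ℕ} {d : ℕ}
    (S : PlainQuantumStrategy l n k d) (p : Behavior l n k) : Prop :=
  ∀ x y b, (p x y b : ℂ) = (S.state x * S.meas y b).trace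

/-- The receiver's measurements are compatible. -/
def PlainQuantumStrategy.Compatible {l n : ℕ} {k : Fin n → ℕ} {d : ℕ}
    (S : PlainQuantumStrategy l n k d) : Prop :=
  IsCompatible S.meas

/-- `C_d`: classical `d`-dimensional communication with shared randomness. -/
def classicalSet (l n : ℕ) (k : Fin n → ℕ) (d : ℕ) : Set (Behavior l n k) :=
  {p | ∃ (Ω : Type) (_ : MeasurableSpace Ω) (π : MeasureTheory.Measure Ω)
      (_ : MeasureTheory.IsProbabilityMeasure π) (S : ClassicalStrategy Ω l n k d),
      S.Realizes π p}

/-- `Q^C_d`: quantum `d`-dimensional communication with shared randomness and compatible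
measurements. -/
def compatibleQuantumSet (l n : ℕ) (k : Fin n → ℕ) (d : ℕ) : Set (Behavior l n k) :=
  {p | ∃ (Ω : Type) (_ : MeasurableSpace Ω) (π : MeasureTheory.Measure Ω)
      (_ : MeasureTheory.IsProbabilityMeasure π) (S : QuantumStrategy Ω l n k d),
      S.Compatible ∧ S.Realizes π p}

/-- `Q̄^C_d`: quantum `d`-dimensional communication without shared randomness, with compatible
measurements. -/
def plainCompatibleQuantumSet (l n : ℕ) (k : Fin n → ℕ) (d : ℕ) : Set (Behavior l n k) :=
  {p | ∃ S : PlainQuantumStrategy l n k d, S.Compatible ∧ S.Realizes p}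

/-- The figure of merit `f` takes a larger value at `p` than at every table that can be obtained
by classical `d`-dimensional communication with shared randomness. -/
def IsAdvantage {l n : ℕ} {k : Fin n → ℕ} (d : ℕ) (f : Behavior l n k → ℝ)
    (p : Behavior l n k) : Prop :=
  ∀ q ∈ classicalSet l n k d, f q < f p

end PrepMeas

namespace PrepMeas

/-! The substance is `Q^C_d ⊆ C_d`. At a fixed value of the shared randomness, compatible
measurements are marginals of one POVM `G` indexed by response functions `f : y ↦ b`. The
Frenkel–Weiner inequality (`IsPOVM.exists_weights`) replaces measuring `G` by this protocol: draw a
`d`-tuple of response functions, let the sender announce the position of the best one, and let the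
receiver apply it.

The tuple weights come from determinants: by Cauchy–Binet, `det (∑ f ∈ B, G f)` is the probability
that the whole tuple lies in `B`. The determinant of an effect is at most its least eigenvalue,
hence at most its expectation in any state. For `B = {f | c f ≤ t}` this says that the best reward
in the tuple stochastically dominates the reward from measuring.

The weights depend neither on the state nor on the reward, so one tuple serves all inputs `x`.
Hahn–Banach separation then puts the table into the polytope of deterministic strategies. This set
is closed and convex, so averaging over the shared randomness stays inside it. Conversely, classical
messages are diagonal states. -/

/-! ### Determinants of sums of effects. -/

/-- A form of the Cauchy–Binet formula in which the sum runs over all maps, not only over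
increasing ones. -/
theorem factorial_mul_det_mul {m J R : Type*} [Fintype m] [DecidableEq m] [Fintype J]
    [CommRing R] (V : Matrix m J R) (W : Matrix J m R) :
    ((Fintype.card m).factorial : R) * (V * W).det =
      ∑ s : m → J, (V.submatrix id s).det * (W.submatrix s id).det := by
  classical
  have expand : (V * W).det = ∑ s : m → J, (∏ i, V i (s i)) * (W.submatrix s id).det := by
    have h : (V * W : Matrix m m R) = fun i => ∑ j, V i j • W j := by
      ext i j
      simp [Matrix.mul_apply]
    change Matrix.detRowAlternating (V * W) = _
    rw [h]
    refine (MultilinearMap.map_sum (Matrix.detRowAlternating (n := m) (R := R)).toMultilinearMap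
      (fun i j => V i j • W j)).trans ?_
    refine Finset.sum_congr rfl fun s _ => ?_
    rw [MultilinearMap.map_smul_univ]
    rfl
  -- Reindexing `s` by `σ` costs one sign in the minor of `W`, which cancels the Leibniz sign. Every
  -- permutation thus contributes `det (V * W)`, whence the factorial.
  have term (σ : Equiv.Perm m) :
      ∑ s : m → J, ((σ.sign : ℤ) : R) * (∏ i, V (σ i) (s i)) * (W.submatrix s id).det =
        (V * W).det := by
    rw [expand, ← Equiv.sum_comp (Equiv.arrowCongr σ.symm (Equiv.refl J))]
    refine Finset.sum_congr rfl fun s _ => ?_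
    have hW : (W.submatrix (Equiv.arrowCongr σ.symm (Equiv.refl J) s) id).det =
        ((σ.sign : ℤ) : R) * (W.submatrix s id).det := by
      rw [← Matrix.det_permute]
      rfl
    have hV : ∏ i, V (σ i) (Equiv.arrowCongr σ.symm (Equiv.refl J) s i) = ∏ i, V i (s i) :=
      Equiv.prod_comp σ fun i => V i (s i)
    have hs : ((σ.sign : ℤ) : R) * ((σ.sign : ℤ) : R) = 1 := by
      rw [← Int.cast_mul, ← Units.val_mul, Int.units_mul_self]
      simp
    rw [hW, hV]
    linear_combination (∏ i, V i (s i)) * (W.submatrix s id).det * hs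
  simp_rw [Matrix.det_apply' (V.submatrix id _), Finset.sum_mul, Matrix.submatrix_apply, id]
  rw [Finset.sum_comm, Finset.sum_congr rfl fun σ _ => term σ]
  simp [Fintype.card_perm]

/-- The determinant of the sum of a subfamily of a finite family of positive semidefinite `d × d`
matrices is the total weight of the `d`-tuples of indices that lie in the subfamily, for
nonnegative weights that do not depend on the subfamily. -/
theorem exists_weights_det_sum {F : Type} [Fintype F] {d : ℕ}
    (G : F → Matrix (Fin d) (Fin d) ℂ) (hG : ∀ f, (G f).PosSemidef) :
    ∃ (S : Type) (_ : Fintype S) (h : S → Fin d → F) (w : S → ℝ), (∀ s, 0 ≤ w s) ∧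
      ∀ (B : F → Prop) [DecidablePred B],
        (∑ f with B f, G f).det = ((∑ s with ∀ i, B (h s i), w s : ℝ) : ℂ) := by
  classical
  have hfac (f : F) : ∃ A : Matrix (Fin d) (Fin d) ℂ, G f = A * A.conjTranspose := by
    open scoped MatrixOrder in
    obtain ⟨A, hA⟩ := CStarAlgebra.nonneg_iff_eq_mul_star_self.mp (hG f).nonneg
    exact ⟨A, hA⟩
  choose A hA using hfac
  -- The columns of all the factors `A f` side by side. A choice of `d` columns has weight `|minor|²
  -- / d!`, and `h` remembers only which `f` each column came from.
  let V : Matrix (Fin d) (F × Fin d) ℂ := Matrix.of fun i j => A j.1 i j.2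
  refine ⟨Fin d → F × Fin d, inferInstance, fun s i => (s i).1,
    fun s => Complex.normSq (V.submatrix id s).det / (d.factorial : ℝ),
    fun s => div_nonneg (Complex.normSq_nonneg _) (by positivity), fun B _ => ?_⟩
  let t : F × Fin d → ℂ := fun j => if B j.1 then 1 else 0
  have hsum : ∑ f with B f, G f = (V * Matrix.diagonal t) * V.conjTranspose := by
    ext a b
    rw [Matrix.mul_apply, Matrix.sum_apply, Finset.sum_filter, Fintype.sum_prod_type]
    simp only [hA, Matrix.mul_diagonal,
      Matrix.conjTranspose_apply, Matrix.of_apply, V, t]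
    refine Finset.sum_congr rfl fun f _ => ?_
    split_ifs <;> simp [Matrix.mul_apply]
  have hcb := factorial_mul_det_mul (V * Matrix.diagonal t) V.conjTranspose
  rw [← hsum, Fintype.card_fin] at hcb
  have hd : (d.factorial : ℂ) ≠ 0 := by exact_mod_cast d.factorial_ne_zero
  rw [← mul_right_inj' hd, hcb]
  push_cast
  rw [Finset.mul_sum, Finset.sum_filter]
  refine Finset.sum_congr rfl fun s _ => ?_
  have h1 : (V * Matrix.diagonal t).submatrix id s =
      V.submatrix id s * Matrix.diagonal (fun i => t (s i)) := by
    ext a b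
    simp [Matrix.mul_diagonal]
  have h2 : V.conjTranspose.submatrix s id = (V.submatrix id s).conjTranspose := rfl
  rw [h1, h2, Matrix.det_mul, Matrix.det_diagonal, Matrix.det_conjTranspose]
  have h3 : ∏ i, t (s i) = if ∀ i, B (s i).1 then 1 else 0 := by
    simp only [t]
    rw [Finset.prod_ite_zero]
    simp
  rw [h3]
  split_ifs
  · rw [mul_one, mul_div_cancel₀ _ hd, Complex.star_def, Complex.mul_conj]
  · simp

/-- The determinant of an effect is a lower bound for its expectation in every state. -/
theorem det_re_le_trace_re {d : ℕ} {ρ E : Matrix (Fin d) (Fin d) ℂ} (hρ : IsState ρ)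
    (hE : E.PosSemidef) (hE' : (1 - E).PosSemidef) : E.det.re ≤ (ρ * E).trace.re := by
  let U : Matrix (Fin d) (Fin d) ℂ := hE.1.eigenvectorUnitary
  let ev := hE.1.eigenvalues
  have hU : U.conjTranspose * U = 1 := Unitary.coe_star_mul_self hE.1.eigenvectorUnitary
  have hU' : U * U.conjTranspose = 1 := Unitary.coe_mul_star_self hE.1.eigenvectorUnitary
  have hspec : E = U * Matrix.diagonal (fun i => (ev i : ℂ)) * U.conjTranspose := by
    have := hE.1.spectral_theorem
    rwa [Unitary.conjStarAlgAut_apply] at this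
  have hev0 (i) : 0 ≤ ev i := hE.eigenvalues_nonneg i
  have hev1 (i) : ev i ≤ 1 := by
    have h := (hE'.conjTranspose_mul_mul_same U).diag_nonneg (i := i)
    have h2 : U.conjTranspose * (1 - E) * U = 1 - Matrix.diagonal (fun i => (ev i : ℂ)) := by
      have h3 : U.conjTranspose * E * U = Matrix.diagonal (fun i => (ev i : ℂ)) := by
        rw [hspec]
        simp only [Matrix.mul_assoc, hU, Matrix.mul_one]
        rw [← Matrix.mul_assoc, hU, Matrix.one_mul]
      rw [Matrix.mul_sub, Matrix.sub_mul, h3, Matrix.mul_one, hU]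
    rw [h2] at h
    simp only [Matrix.sub_apply, Matrix.one_apply_eq, Matrix.diagonal_apply_eq] at h
    have h4 := (Complex.le_def.mp h).1
    simp at h4
    linarith
  let q : Fin d → ℝ := fun i => ((U.conjTranspose * ρ * U) i i).re
  have hq0 (i) : 0 ≤ q i :=
    (Complex.le_def.mp ((hρ.1.conjTranspose_mul_mul_same U).diag_nonneg (i := i))).1
  have hq1 : ∑ i, q i = 1 := by
    have h : (U.conjTranspose * ρ * U).trace = 1 := by
      rw [Matrix.trace_mul_comm, ← Matrix.mul_assoc, hU', Matrix.one_mul, hρ.2]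
    simpa [Matrix.trace, q] using congrArg Complex.re h
  have hdet : E.det.re = ∏ i, ev i := by
    rw [hE.1.det_eq_prod_eigenvalues]
    exact_mod_cast Complex.ofReal_re (∏ i, ev i)
  have htr : (ρ * E).trace.re = ∑ i, q i * ev i := by
    have h : (ρ * E).trace =
        ((U.conjTranspose * ρ * U) * Matrix.diagonal (fun i => (ev i : ℂ))).trace := by
      conv_lhs => rw [hspec]
      rw [Matrix.mul_assoc (U.conjTranspose * ρ), Matrix.mul_assoc U.conjTranspose,
        Matrix.trace_mul_comm U.conjTranspose]
      simp only [Matrix.mul_assoc]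
    rw [h]
    simp [Matrix.trace, Matrix.mul_diagonal, q]
  -- `q` is a probability vector, so it suffices that the product of the eigenvalues is at most each
  -- of them; all lie in `[0, 1]`.
  rw [hdet, htr, ← one_mul (∏ i, ev i), ← hq1, Finset.sum_mul]
  refine Finset.sum_le_sum fun i _ => mul_le_mul_of_nonneg_left ?_ (hq0 i)
  rw [← Finset.mul_prod_erase _ _ (Finset.mem_univ i)]
  exact mul_le_of_le_one_right (hev0 i)
    (Finset.prod_le_one (fun j _ => hev0 j) fun j _ => hev1 j)

/-! ### Stochastic dominance and the Frenkel–Weiner inequality. -/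

theorem intervalIntegrable_ite_le (a b c : ℝ) :
    IntervalIntegrable (fun t : ℝ => if c ≤ t then (1 : ℝ) else 0) MeasureTheory.volume a b := by
  refine Monotone.intervalIntegrable fun s t hst => ?_
  split_ifs with h1 h2
  · exact le_rfl
  · exact absurd (h1.trans hst) h2
  · exact zero_le_one
  · exact le_rfl

theorem integral_ite_le {a b c : ℝ} (hac : a ≤ c) (hcb : c ≤ b) :
    ∫ t in a..b, (if c ≤ t then (1 : ℝ) else 0) = b - c := by
  rw [← intervalIntegral.integral_add_adjacent_intervals (intervalIntegrable_ite_le a c c)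
    (intervalIntegrable_ite_le c b c)]
  have h1 : ∫ t in a..c, (if c ≤ t then (1 : ℝ) else 0) = ∫ _ in a..c, (0 : ℝ) := by
    refine intervalIntegral.integral_congr_ae ?_
    filter_upwards [MeasureTheory.Measure.ae_ne MeasureTheory.volume c] with t ht hmem
    rw [Set.uIoc_of_le hac] at hmem
    exact if_neg (not_le.mpr (lt_of_le_of_ne hmem.2 ht))
  have h2 : ∫ t in c..b, (if c ≤ t then (1 : ℝ) else 0) = ∫ _ in c..b, (1 : ℝ) := by
    refine intervalIntegral.integral_congr fun t ht => ?_
    rw [Set.uIcc_of_le hcb] at ht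
    exact if_pos ht.1
  simp [h1, h2]

theorem sum_filter_le_eq {X : Type*} [Fintype X] (r u : X → ℝ) (t : ℝ) :
    ∑ x with u x ≤ t, r x = ∑ x, r x * (if u x ≤ t then (1 : ℝ) else 0) := by
  simp [Finset.sum_filter]

theorem intervalIntegrable_sum_filter_le {X : Type*} [Fintype X] (a b : ℝ) (r u : X → ℝ) :
    IntervalIntegrable (fun t => ∑ x with u x ≤ t, r x) MeasureTheory.volume a b := by
  simp_rw [sum_filter_le_eq]
  have := IntervalIntegrable.sum Finset.univ
    fun x _ => (intervalIntegrable_ite_le a b (u x)).const_mul (r x)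
  simpa [Finset.sum_fn] using this

/-- Layer-cake formula: a mass `r x` at `u x` is counted for `t` from `u x` to `b`. -/
theorem integral_sum_filter_le {X : Type*} [Fintype X] {a b : ℝ} (r u : X → ℝ)
    (hu : ∀ x, a ≤ u x ∧ u x ≤ b) :
    ∫ t in a..b, ∑ x with u x ≤ t, r x = (∑ x, r x) * b - ∑ x, r x * u x := by
  simp_rw [sum_filter_le_eq]
  rw [intervalIntegral.integral_finsetSum
    fun x _ => (intervalIntegrable_ite_le a b (u x)).const_mul (r x)]
  simp_rw [intervalIntegral.integral_const_mul]
  rw [Finset.sum_mul, ← Finset.sum_sub_distrib]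
  refine Finset.sum_congr rfl fun x _ => ?_
  rw [integral_ite_le (hu x).1 (hu x).2, mul_sub]

/-- Stochastic dominance on finite spaces: if the distribution function of `e` lies below the one
of `c`, then `e` has the larger expectation. -/
theorem sum_mul_le_sum_mul_of_dominates {F S : Type*} [Fintype F] [Fintype S]
    (q c : F → ℝ) (w e : S → ℝ) (htot : ∑ f, q f = ∑ s, w s)
    (hdom : ∀ t, ∑ s with e s ≤ t, w s ≤ ∑ f with c f ≤ t, q f) :
    ∑ f, q f * c f ≤ ∑ s, w s * e s := by
  obtain ⟨b, hb⟩ := (Set.finite_range (Sum.elim c e)).bddAbove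
  obtain ⟨a, ha⟩ := (Set.finite_range (Sum.elim c e)).bddBelow
  -- The bounds can be in the wrong order only if there are no values at all.
  rcases lt_or_ge b a with hab | hab
  · have hne (x : F ⊕ S) : False :=
      absurd (ha (Set.mem_range_self x)) (not_le.mpr ((hb (Set.mem_range_self x)).trans_lt hab))
    have : IsEmpty F := ⟨fun f => hne (.inl f)⟩
    have : IsEmpty S := ⟨fun s => hne (.inr s)⟩
    simp
  have hle := intervalIntegral.integral_mono_on hab
    (intervalIntegrable_sum_filter_le a b w e) (intervalIntegrable_sum_filter_le a b q c)
    fun t _ => hdom t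
  rw [integral_sum_filter_le w e fun s => ⟨ha ⟨.inr s, rfl⟩, hb ⟨.inr s, rfl⟩⟩,
    integral_sum_filter_le q c fun f => ⟨ha ⟨.inl f, rfl⟩, hb ⟨.inl f, rfl⟩⟩, htot] at hle
  linarith

/-- The Frenkel–Weiner inequality: for a measurement on `ℂ^d` there is a distribution of
`d`-tuples of outcomes such that, whatever the state and the reward `c`, a sender who picks the
best outcome in the tuple is rewarded at least as well as by measuring the state. -/
theorem IsPOVM.exists_weights {F : Type} [Fintype F] {d : ℕ}
    {G : F → Matrix (Fin d) (Fin d) ℂ} (hG : IsPOVM G) :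
    ∃ (S : Type) (_ : Fintype S) (h : S → Fin d → F) (w : S → ℝ), (∀ s, 0 ≤ w s) ∧
      ∑ s, w s = 1 ∧
      ∀ (ρ : Matrix (Fin d) (Fin d) ℂ) (c : F → ℝ) (m : S → Fin d), IsState ρ →
        (∀ s i, c (h s i) ≤ c (h s (m s))) →
        ∑ f, (ρ * G f).trace.re * c f ≤ ∑ s, w s * c (h s (m s)) := by
  classical
  obtain ⟨hpos, hsum⟩ := (isPOVM_iff_sum G).mp hG
  obtain ⟨S, hS, h, w, hw, hdet⟩ := exists_weights_det_sum G hpos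
  have hw1 : ∑ s, w s = 1 := by
    have := hdet fun _ => True
    simp only [Finset.filter_true, hsum, Matrix.det_one, implies_true] at this
    exact_mod_cast this.symm
  refine ⟨S, hS, h, w, hw, hw1, fun ρ c m hρ hm => ?_⟩
  have htr (A : Finset F) : (ρ * ∑ f ∈ A, G f).trace.re = ∑ f ∈ A, (ρ * G f).trace.re := by
    rw [Finset.mul_sum, Matrix.trace_sum, Complex.re_sum]
  refine sum_mul_le_sum_mul_of_dominates _ _ _ _ ?_ fun t => ?_
  · rw [hw1, ← htr, hsum, Matrix.mul_one, hρ.2, Complex.one_re]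
  -- The best entry is at most `t` iff the whole tuple lies in `{c ≤ t}`, an event whose weight is a
  -- determinant.
  · have hiff (s : S) : c (h s (m s)) ≤ t ↔ ∀ i, c (h s i) ≤ t :=
      ⟨fun H i => (hm s i).trans H, fun H => H _⟩
    simp_rw [hiff]
    have := congrArg Complex.re (hdet fun f => c f ≤ t)
    rw [Complex.ofReal_re] at this
    rw [← this, ← htr]
    refine det_re_le_trace_re hρ (Matrix.posSemidef_sum _ fun f _ => hpos f) ?_
    rw [← hsum, ← Finset.sum_filter_add_sum_filter_not Finset.univ (fun f => c f ≤ t) G,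
      add_sub_cancel_left]
    exact Matrix.posSemidef_sum _ fun f _ => hpos f

/-! ### Joint measurements of compatible families. -/

theorem summable_smul_of_mem_Icc {K : Type*} {d : ℕ} {G : K → Matrix (Fin d) (Fin d) ℂ}
    (hG : Summable G) {r : K → ℝ} (h0 : ∀ κ, 0 ≤ r κ) (h1 : ∀ κ, r κ ≤ 1) :
    Summable fun κ => (r κ : ℂ) • G κ := by
  refine Pi.summable.mpr fun i => Pi.summable.mpr fun j => ?_
  have hij : Summable fun κ => G κ i j := Pi.summable.mp (Pi.summable.mp hG i) j
  refine Summable.of_norm_bounded hij.norm fun κ => ?_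
  rw [Matrix.smul_apply, smul_eq_mul, norm_mul, Complex.norm_real, Real.norm_of_nonneg (h0 κ)]
  exact mul_le_of_le_one_left (norm_nonneg _) (h1 κ)

theorem posSemidef_of_hasSum {K : Type*} {d : ℕ} {G : K → Matrix (Fin d) (Fin d) ℂ}
    {A : Matrix (Fin d) (Fin d) ℂ} (hG : ∀ κ, (G κ).PosSemidef) (hA : HasSum G A) :
    A.PosSemidef := by
  refine .of_dotProduct_mulVec_nonneg ?_ fun x => ?_
  · have h : HasSum G A.conjTranspose := by
      convert hA.matrix_conjTranspose using 1
      exact funext fun κ => (hG κ).1.symm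
    exact h.unique hA
  · let φ : Matrix (Fin d) (Fin d) ℂ →+ ℂ :=
      { toFun := fun B => star x ⬝ᵥ B.mulVec x
        map_zero' := by simp
        map_add' := fun B C => by rw [Matrix.add_mulVec, dotProduct_add] }
    have hφ : Continuous φ :=
      continuous_const.dotProduct (continuous_id.matrix_mulVec continuous_const)
    have : HasSum (fun κ => φ (G κ)) (φ A) := hA.map φ hφ
    exact this.nonneg fun κ => (hG κ).dotProduct_mulVec_nonneg x

theorem sum_filter_prod_eq {n : ℕ} {k : Fin n → ℕ} (P : (y : Fin n) → Fin (k y) → ℝ)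
    (hP : ∀ y, ∑ b, P y b = 1) (y : Fin n) (b : Fin (k y)) :
    ∑ f : (y : Fin n) → Fin (k y) with f y = b, ∏ z, P z (f z) = P y b := by
  have h : (Finset.univ.filter fun f : (y : Fin n) → Fin (k y) => f y = b) =
      Fintype.piFinset
        (Function.update (fun z => (Finset.univ : Finset (Fin (k z)))) y {b}) := by
    rw [Fintype.piFinset_update_singleton_eq_filter_piFinset_eq
      (fun z => (Finset.univ : Finset (Fin (k z)))) y (Finset.mem_univ b),
      Fintype.piFinset_univ]
  rw [h, ← Finset.prod_univ_sum, ← Finset.mul_prod_erase _ _ (Finset.mem_univ y)]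
  rw [Function.update_self, Finset.sum_singleton, Finset.prod_eq_one, mul_one]
  intro z hz
  rw [Function.update_of_ne (Finset.ne_of_mem_erase hz), hP]

/-- A compatible family of finitely many measurements has a parent POVM whose outcomes are the
tuples of outcomes of the measurements, with the marginals as post-processing. -/
theorem IsCompatible.exists_joint {n d : ℕ} {k : Fin n → ℕ}
    {M : (y : Fin n) → Fin (k y) → Matrix (Fin d) (Fin d) ℂ} (hM : IsCompatible M) :
    ∃ G : ((y : Fin n) → Fin (k y)) → Matrix (Fin d) (Fin d) ℂ,
      IsPOVM G ∧ ∀ y b, M y b = ∑ f with f y = b, G f := by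
  obtain ⟨K, G, P, ⟨hG, hG1⟩, hP0, hP1, hMG⟩ := hM
  -- Given `κ`, the answers to the different `y` are drawn independently.
  let r (f : (y : Fin n) → Fin (k y)) (κ : K) : ℝ := ∏ z, P z κ (f z)
  have hr0 (f κ) : 0 ≤ r f κ := Finset.prod_nonneg fun z _ => hP0 z κ _
  have hr1 (f κ) : r f κ ≤ 1 := Finset.prod_le_one (fun z _ => hP0 z κ _) fun z _ =>
    (hP1 z κ) ▸ Finset.single_le_sum (fun b _ => hP0 z κ b) (Finset.mem_univ (f z))
  have hs (f) : Summable fun κ => (r f κ : ℂ) • G κ :=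
    summable_smul_of_mem_Icc hG1.summable (hr0 f) (hr1 f)
  have hsum (A : Finset ((y : Fin n) → Fin (k y))) :
      HasSum (fun κ => ((∑ f ∈ A, r f κ : ℝ) : ℂ) • G κ) (∑ f ∈ A, ∑' κ, (r f κ : ℂ) • G κ) := by
    have := hasSum_sum fun f (_ : f ∈ A) => (hs f).hasSum
    simpa only [← Finset.sum_smul, ← Complex.ofReal_sum] using this
  refine ⟨fun f => ∑' κ, (r f κ : ℂ) • G κ, (isPOVM_iff_sum _).mpr ⟨fun f => ?_, ?_⟩,
    fun y b => ?_⟩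
  · refine posSemidef_of_hasSum (fun κ => (hG κ).smul ?_) (hs f).hasSum
    exact_mod_cast hr0 f κ
  · refine (hsum Finset.univ).unique ?_
    have h (κ : K) : ∑ f, r f κ = 1 := by
      rw [← Finset.prod_eq_one fun z (_ : z ∈ Finset.univ) => hP1 z κ]
      simp only [r]
      rw [Finset.prod_univ_sum, Fintype.piFinset_univ]
    simpa [h] using hG1
  · refine (hMG y b).unique ?_
    convert hsum (Finset.univ.filter fun f => f y = b) using 3 with κ
    exact congrArg _ (sum_filter_prod_eq (fun z => P z κ) (fun z => hP1 z κ) y b).symm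

/-! ### The polytope of deterministic strategies. -/

/-- The table of the deterministic classical strategy with encoding `g` and decoding `h`. -/
def deterministicBehavior {l n : ℕ} {k : Fin n → ℕ} {d : ℕ} (g : Fin l → Fin d)
    (h : Fin d → (y : Fin n) → Fin (k y)) : Behavior l n k :=
  fun x y b => if h (g x) y = b then 1 else 0

/-- The polytope spanned by the tables of deterministic classical strategies. -/
def deterministicHull (l n : ℕ) (k : Fin n → ℕ) (d : ℕ) : Set (Behavior l n k) :=
  convexHull ℝ (Set.range fun s : (Fin l → Fin d) × (Fin d → (y : Fin n) → Fin (k y)) =>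
    deterministicBehavior s.1 s.2)

theorem isClosed_deterministicHull (l n : ℕ) (k : Fin n → ℕ) (d : ℕ) :
    IsClosed (deterministicHull l n k d) :=
  (Set.finite_range _).isClosed_convexHull ℝ

theorem deterministicHull_subset_Icc (l n : ℕ) (k : Fin n → ℕ) (d : ℕ) :
    deterministicHull l n k d ⊆ Set.Icc 0 1 := by
  refine convexHull_min ?_ (convex_Icc 0 1)
  rintro _ ⟨s, rfl⟩
  refine ⟨fun x y b => ?_, fun x y b => ?_⟩ <;>
  · simp only [deterministicBehavior, Pi.zero_apply, Pi.one_apply]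
    split_ifs <;> norm_num

/-- The coefficients of a convex combination serve as the distribution of a finite, discrete shared
randomness. -/
theorem deterministicHull_subset_classicalSet (l n : ℕ) (k : Fin n → ℕ) (d : ℕ) :
    deterministicHull l n k d ⊆ classicalSet l n k d := by
  intro p hp
  obtain ⟨Ω, _, w, z, hw0, hw1, hz, rfl⟩ := mem_convexHull_iff_exists_fintype.mp hp
  choose s hs using hz
  let _ : MeasurableSpace Ω := ⊤
  let π : PMF Ω := PMF.ofFintype (fun ω => ENNReal.ofReal (w ω)) (by
    rw [← ENNReal.ofReal_sum_of_nonneg fun ω _ => hw0 ω, hw1, ENNReal.ofReal_one])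
  refine ⟨Ω, inferInstance, π.toMeasure, inferInstance,
    { enc := fun x ω m => if (s ω).1 x = m then 1 else 0
      dec := fun y m ω b => if (s ω).2 m y = b then 1 else 0
      enc_nonneg := fun x ω m => by split_ifs <;> norm_num
      enc_sum := fun x ω => by simp
      dec_nonneg := fun y m ω b => by split_ifs <;> norm_num
      dec_sum := fun y m ω => by simp
      enc_measurable := fun x m => measurable_from_top
      dec_measurable := fun y m b => measurable_from_top }, fun x y b => ?_⟩
  simp only [PMF.integral_eq_sum, Finset.sum_apply, Pi.smul_apply]
  rw [Finset.sum_comm]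
  refine Finset.sum_congr rfl fun ω _ => ?_
  rw [← Finset.smul_sum, ← hs ω]
  have hπ : (π ω).toReal = w ω := by
    simp [π, PMF.ofFintype_apply, ENNReal.toReal_ofReal (hw0 ω)]
  rw [hπ]
  simp only [deterministicBehavior, smul_eq_mul, ite_mul, one_mul, zero_mul, Finset.sum_ite_eq,
    Finset.mem_univ, if_true]

/-- States on `ℂ^d` and compatible measurements only produce tables of classical communication of
a `d`-level system. -/
theorem IsCompatible.mem_deterministicHull {l n d : ℕ} {k : Fin n → ℕ}
    {M : (y : Fin n) → Fin (k y) → Matrix (Fin d) (Fin d) ℂ} (hM : IsCompatible M)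
    {ρ : Fin l → Matrix (Fin d) (Fin d) ℂ} (hρ : ∀ x, IsState (ρ x)) :
    (fun x y b => (ρ x * M y b).trace.re) ∈ deterministicHull l n k d := by
  obtain ⟨G, hG, hMG⟩ := hM.exists_joint
  obtain ⟨S, _, h, w, hw0, hw1, hle⟩ := hG.exists_weights
  set p : Behavior l n k := fun x y b => (ρ x * M y b).trace.re with hp
  by_contra hnot
  obtain ⟨φ, u, hφ, hu⟩ := geometric_hahn_banach_closed_point (convex_convexHull ℝ _)
    (isClosed_deterministicHull l n k d) hnot
  -- The row of input `x` alone, answered by `f`; all other rows vanish. Both `p` and the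
  -- deterministic tables are combinations of these, so `φ (e x f)` is the reward for answering `x`
  -- by `f`.
  let e (x : Fin l) (f : (y : Fin n) → Fin (k y)) : Behavior l n k :=
    Pi.single x fun y b => if f y = b then 1 else 0
  have hdet (g : Fin l → Fin d) (t : Fin d → (y : Fin n) → Fin (k y)) :
      deterministicBehavior g t = ∑ x, e x (t (g x)) := by
    rw [Finset.univ_sum_single]
    rfl
  have hp_eq : p = ∑ x, ∑ f, (ρ x * G f).trace.re • e x f := by
    have hx (x : Fin l) : ∑ f, (ρ x * G f).trace.re • e x f = Pi.single x (p x) := by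
      ext x' y b
      by_cases hxx : x' = x
      · subst hxx
        simp [e, hp, hMG, Finset.mul_sum, Matrix.trace_sum, Finset.sum_apply, ← Finset.sum_filter]
      · simp [e, Finset.sum_apply, hxx]
    simp_rw [hx]
    rw [Finset.univ_sum_single]
  have hbest (x : Fin l) (s : S) : ∃ m, ∀ i, φ (e x (h s i)) ≤ φ (e x (h s m)) := by
    -- For `d = 0` there is no state, since the trace would be `0`.
    have : Nonempty (Fin d) := by
      by_contra hne
      rw [not_nonempty_iff] at hne
      have := (hρ x).2
      simp [Matrix.trace] at this
    exact Finite.exists_max fun i => φ (e x (h s i))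
  choose m hm using hbest
  -- The position `m x s` depends on `x` but the tuple `h s` does not, so each `s` gives one
  -- deterministic strategy.
  have h1 : φ p ≤ ∑ s, w s * φ (deterministicBehavior (fun x => m x s) (h s)) := by
    simp only [hp_eq, hdet, map_sum, map_smul, smul_eq_mul, Finset.mul_sum]
    rw [Finset.sum_comm (s := Finset.univ (α := S))]
    exact Finset.sum_le_sum fun x _ => hle (ρ x) (fun f => φ (e x f)) (m x) (hρ x) (hm x)
  have h2 : ∑ s, w s * φ (deterministicBehavior (fun x => m x s) (h s)) ≤ ∑ s, w s * u :=
    Finset.sum_le_sum fun s _ => mul_le_mul_of_nonneg_left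
      (hφ _ (subset_convexHull ℝ _ ⟨(_, _), rfl⟩)).le (hw0 s)
  rw [← Finset.sum_mul, hw1, one_mul] at h2
  exact absurd hu (not_lt.mpr (h1.trans h2))

/-- Conjugation reverses the product of Hermitian matrices, and the trace is cyclic. -/
theorem ofReal_trace_mul_re {d : ℕ} {A B : Matrix (Fin d) (Fin d) ℂ} (hA : A.IsHermitian)
    (hB : B.IsHermitian) : (((A * B).trace.re : ℝ) : ℂ) = (A * B).trace := by
  rw [← Complex.conj_eq_iff_re, ← Complex.star_def, ← Matrix.trace_conjTranspose,
    Matrix.conjTranspose_mul, hA.eq, hB.eq, Matrix.trace_mul_comm]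

theorem compatibleQuantumSet_subset_deterministicHull (l n : ℕ) (k : Fin n → ℕ) (d : ℕ) :
    compatibleQuantumSet l n k d ⊆ deterministicHull l n k d := by
  rintro p ⟨Ω, _, π, _, S, ⟨K, G, P, hG, hP0, hP1, hMG⟩, hp⟩
  let q (ω : Ω) : Behavior l n k := fun x y b => (S.state x ω * S.meas y ω b).trace.re
  -- Only the slice of `P` at a fixed `ω` enters, so its dependence on `ω` need not be measurable.
  have hq (ω) : q ω ∈ deterministicHull l n k d :=
    IsCompatible.mem_deterministicHull (M := fun y => S.meas y ω)
      ⟨K, G, fun y => P (y, ω), hG, fun y => hP0 (y, ω), fun y => hP1 (y, ω),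
        fun y => hMG (y, ω)⟩ fun x => S.isState x ω
  have hmeas (x y b) : Measurable fun ω => q ω x y b := by
    refine Complex.measurable_re.comp ?_
    simp only [Matrix.trace, Matrix.diag_apply, Matrix.mul_apply]
    exact Finset.measurable_sum _ fun i _ => Finset.measurable_sum _ fun j _ =>
      (S.state_measurable x i j).mul (S.meas_measurable y b j i)
  have hint (x y b) : MeasureTheory.Integrable (fun ω => q ω x y b) π := by
    refine .of_bound (hmeas x y b).aestronglyMeasurable 1 (.of_forall fun ω => ?_)
    have := deterministicHull_subset_Icc l n k d (hq ω)
    rw [Real.norm_of_nonneg (this.1 x y b)]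
    exact this.2 x y b
  have hint2 (x y) : MeasureTheory.Integrable (fun ω => q ω x y) π := .of_eval (hint x y)
  have hint1 (x) : MeasureTheory.Integrable (fun ω => q ω x) π := .of_eval (hint2 x)
  have hint0 : MeasureTheory.Integrable q π := .of_eval hint1
  have hpq : p = ∫ ω, q ω ∂π := by
    ext x y b
    rw [MeasureTheory.eval_integral hint1, MeasureTheory.eval_integral (hint2 x),
      MeasureTheory.eval_integral (hint x y)]
    have := hp x y b
    rw [← Complex.ofReal_inj, this, ← integral_complex_ofReal]
    exact MeasureTheory.integral_congr_ae (.of_forall fun ω =>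
      (ofReal_trace_mul_re (S.isState x ω).1.1 ((S.isPOVM y ω).1 b).1).symm)
  rw [hpq]
  exact (convex_convexHull ℝ _).integral_mem (isClosed_deterministicHull l n k d)
    (.of_forall hq) hint0

/-! ### Diagonal simulation and comparison of the sets. -/

/-- A classical `d`-level system is simulated by diagonal states and measurements on `ℂ^d`. -/
theorem classicalSet_subset_compatibleQuantumSet (l n : ℕ) (k : Fin n → ℕ) (d : ℕ) :
    classicalSet l n k d ⊆ compatibleQuantumSet l n k d := by
  rintro p ⟨Ω, _, π, _, S, hp⟩
  have diag_psd {v : Fin d → ℝ} (hv : ∀ m, 0 ≤ v m) :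
      (Matrix.diagonal fun m => (v m : ℂ)).PosSemidef :=
    .diagonal fun m => by simpa using hv m
  have diag_meas {v : Ω → Fin d → ℝ} (hv : ∀ m, Measurable fun ω => v ω m) (i j : Fin d) :
      Measurable fun ω => (Matrix.diagonal fun m => (v ω m : ℂ)) i j := by
    by_cases hij : i = j
    · subst hij
      simpa [Function.comp_def] using Complex.measurable_ofReal.comp (hv i)
    · simp [Matrix.diagonal_apply_ne _ hij]
  have diag_povm {m : ℕ} {v : Fin m → Fin d → ℝ} (hv : ∀ b i, 0 ≤ v b i)
      (hsum : ∀ i, ∑ b, v b i = 1) :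
      IsPOVM fun b => Matrix.diagonal fun i => (v b i : ℂ) := by
    refine (isPOVM_iff_sum _).mpr ⟨fun b => diag_psd (hv b), ?_⟩
    rw [← Matrix.diagonal_one]
    ext i j
    rw [Matrix.sum_apply]
    by_cases hij : i = j
    · subst hij
      simp only [Matrix.diagonal_apply_eq]
      exact_mod_cast hsum i
    · simp [Matrix.diagonal_apply_ne _ hij]
  let T : QuantumStrategy Ω l n k d :=
    { state := fun x ω => Matrix.diagonal fun m => (S.enc x ω m : ℂ)
      meas := fun y ω b => Matrix.diagonal fun m => (S.dec y m ω b : ℂ)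
      isState := fun x ω => ⟨diag_psd (S.enc_nonneg x ω), by
        rw [Matrix.trace_diagonal]
        exact_mod_cast S.enc_sum x ω⟩
      isPOVM := fun y ω => diag_povm (fun b m => S.dec_nonneg y m ω b)
        fun m => S.dec_sum y m ω
      state_measurable := fun x => diag_meas (S.enc_measurable x)
      meas_measurable := fun y b => diag_meas fun m => S.dec_measurable y m b }
  -- The parent is the measurement in the standard basis, and the decoder is the post-processing.
  have hT : T.Compatible := by
    refine ⟨Fin d, fun m => Matrix.diagonal fun i => ((if i = m then 1 else 0 : ℝ) : ℂ),
      fun i m b => S.dec i.1 m i.2 b,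
      diag_povm (fun m i => by split_ifs <;> norm_num) fun i => by simp,
      fun i m b => S.dec_nonneg i.1 m i.2 b, fun i m => S.dec_sum i.1 m i.2, fun i b => ?_⟩
    convert hasSum_fintype fun m => (S.dec i.1 m i.2 b : ℂ) •
      Matrix.diagonal fun j : Fin d => ((if j = m then 1 else 0 : ℝ) : ℂ) using 1
    ext a c
    rw [Matrix.sum_apply]
    by_cases hac : a = c
    · subst hac
      simp [T, apply_ite]
    · simp [T, Matrix.diagonal_apply_ne _ hac]
  refine ⟨Ω, inferInstance, π, inferInstance, T, hT, fun x y b => ?_⟩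
  have henc (x ω m) : S.enc x ω m ≤ 1 :=
    S.enc_sum x ω ▸ Finset.single_le_sum (fun i _ => S.enc_nonneg x ω i) (Finset.mem_univ m)
  have hdec (y m ω b) : S.dec y m ω b ≤ 1 :=
    S.dec_sum y m ω ▸ Finset.single_le_sum (fun i _ => S.dec_nonneg y m ω i) (Finset.mem_univ b)
  have hint (m : Fin d) :
      MeasureTheory.Integrable (fun ω => S.enc x ω m * S.dec y m ω b) π := by
    refine .of_bound ((S.enc_measurable x m).mul (S.dec_measurable y m b)).aestronglyMeasurable 1
      (.of_forall fun ω => ?_)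
    rw [Real.norm_of_nonneg (mul_nonneg (S.enc_nonneg x ω m) (S.dec_nonneg y m ω b))]
    exact mul_le_one₀ (henc x ω m) (S.dec_nonneg y m ω b) (hdec y m ω b)
  rw [hp x y b, ← MeasureTheory.integral_finsetSum _ fun m _ => hint m, ← integral_complex_ofReal]
  refine MeasureTheory.integral_congr_ae (.of_forall fun ω => ?_)
  simp [T, Matrix.diagonal_mul_diagonal, Matrix.trace_diagonal]

theorem plainCompatibleQuantumSet_subset (l n : ℕ) (k : Fin n → ℕ) (d : ℕ) :
    plainCompatibleQuantumSet l n k d ⊆ compatibleQuantumSet l n k d := by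
  rintro p ⟨S, ⟨K, G, P, hG, hP0, hP1, hMG⟩, hp⟩
  exact ⟨Unit, inferInstance, MeasureTheory.Measure.dirac (), inferInstance,
    { state := fun x _ => S.state x
      meas := fun y _ => S.meas y
      isState := fun x _ => S.isState x
      isPOVM := fun y _ => S.isPOVM y
      state_measurable := fun _ _ _ => measurable_const
      meas_measurable := fun _ _ _ _ => measurable_const },
    ⟨K, G, fun i => P i.1, hG, fun i => hP0 i.1, fun i => hP1 i.1, fun i => hMG i.1⟩,
    fun x y b => by simpa using hp x y b⟩

theorem compatibleQuantumSet_eq_classicalSet (l n : ℕ) (k : Fin n → ℕ) (d : ℕ) :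
    compatibleQuantumSet l n k d = classicalSet l n k d :=
  Set.Subset.antisymm
    ((compatibleQuantumSet_subset_deterministicHull l n k d).trans
      (deterministicHull_subset_classicalSet l n k d))
    (classicalSet_subset_compatibleQuantumSet l n k d)

end PrepMeas

theorem mainTheorem1 (l n : ℕ) (k : Fin n → ℕ) (d : ℕ) :
    PrepMeas.plainCompatibleQuantumSet l n k d ⊆ PrepMeas.compatibleQuantumSet l n k d ∧
    PrepMeas.compatibleQuantumSet l n k d = PrepMeas.classicalSet l n k d ∧
    (∀ (Ω : Type) [MeasurableSpace Ω] (π : MeasureTheory.Measure Ω)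
      [MeasureTheory.IsProbabilityMeasure π] (S : PrepMeas.QuantumStrategy Ω l n k d)
      (p : PrepMeas.Behavior l n k) (f : PrepMeas.Behavior l n k → ℝ),
      S.Realizes π p → PrepMeas.IsAdvantage d f p → ¬ S.Compatible) ∧
    (∀ (S : PrepMeas.PlainQuantumStrategy l n k d)
      (p : PrepMeas.Behavior l n k) (f : PrepMeas.Behavior l n k → ℝ),
      S.Realizes p → PrepMeas.IsAdvantage d f p → ¬ S.Compatible) := by
  refine ⟨PrepMeas.plainCompatibleQuantumSet_subset l n k d,
    PrepMeas.compatibleQuantumSet_eq_classicalSet l n k d, ?_, ?_⟩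
  · intro Ω _ π _ S p f hp hf hS
    exact lt_irrefl _ (hf p (PrepMeas.compatibleQuantumSet_eq_classicalSet l n k d ▸
      ⟨Ω, inferInstance, π, inferInstance, S, hS, hp⟩))
  · intro S p f hp hf hS
    exact lt_irrefl _ (hf p (PrepMeas.compatibleQuantumSet_eq_classicalSet l n k d ▸
      PrepMeas.plainCompatibleQuantumSet_subset l n k d ⟨S, hS, hp⟩))
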